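/- An election has $n$ voters, $m$ candidates and a committee size $k$; an approval profile $A$ assigns to each voter $i$ the set $A(i)$ of candidates that $i$ approves. The Chamberlin–Courant score of a set $W$ of candidates is $\mathrm{CC}_A(W)=\frac1n\,|\{i : A(i)\cap W\neq\emptyset\}|$, and a set $W$ with $|W|=k$ is a $(1-1/e)$-approximate committee for $A$ if $\mathrm{CC}_A(W)\ge(1-1/e)\,\mathrm{CC}_A(W')$ for every set $W'$ of $k$ candidates. In the $p$-inaccurate query model the profile is unknown; an algorithm can query pairs $(i,j)$ of a voter and a candidate, repeatedly if it wishes, and each query is answered by the bit $\mathbf 1[j\in A(i)]\oplus X$, where $X\sim\mathrm{Bernoulli}(p)$ is drawn afresh and independently for every query. Algorithms may be randomized and adaptive (the next query, and the decision to stop and return a set of candidates, may depend on all earlier queries and answers). Let $p\in(0,\tfrac12)$ and $\eta>0$. There is a constant $c>0$, depending only on $p$ and $\eta$, such that the following holds for all integers $n\ge 1$ and $1\le k\le m$ and all real $\delta>0$ with $\delta+\frac km\le 1-\eta$. For every algorithm that, on every approval profile $A$ of $n$ voters over $m$ candidates, with probability at least $1-\delta$ stops and returns a $(1-1/e)$-approximate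 committee of size $k$ for $A$, there is an approval profile $A$ on which its expected number of queries is at least $$c\,n\,m\,\log(1/\delta).$$ (In particular, for fixed $p$ and $k$, and $\delta$ bounded away from $1$, the worst-case expected number of queries is $\Omega(nm\log(1/\delta))$ as $m\to\infty$, uniformly in $n\ge 1$.) -/

import Mathlib

open scoped ENNReal

noncomputable section

/-! ### Approval elections and the Chamberlin-Courant score -/

/-- An approval profile: each of the `n` voters approves a set of the `m` candidates. -/
abbrev ApprovalProfile (n m : ℕ) : Type := Fin n → Finset (Fin m)

/-- The Chamberlin-Courant score of `W`: the fraction of the voters who approve some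
member of `W`. -/
def ccScore {n m : ℕ} (A : ApprovalProfile n m) (W : Finset (Fin m)) : ℝ :=
  (1 / (n : ℝ)) * ∑ i : Fin n, if (A i ∩ W).Nonempty then (1 : ℝ) else 0

/-- `W` is a committee of size `k` whose score is at least `1 - 1/e` times the score of every
committee of size `k`. -/
def IsApproxCommittee {n m : ℕ} (A : ApprovalProfile n m) (k : ℕ) (W : Finset (Fin m)) : Prop :=
  W.card = k ∧
    ∀ W' : Finset (Fin m), W'.card = k → (1 - 1 / Real.exp 1) * ccScore A W' ≤ ccScore A W

/-! ### The inaccurate query model -/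

/-- A query `(i, j)` asks voter `i` whether he or she approves candidate `j`. -/
abbrev ApprovalQuery (n m : ℕ) : Type := Fin n × Fin m

/-- The queries made so far, each with its answer; the most recent one comes first. -/
abbrev Transcript (n m : ℕ) : Type := List (ApprovalQuery n m × Bool)

/-- The law of a Bernoulli variable: `true` with probability `p`, `false` with `1 - p`. -/
def noiseLaw (p : unitInterval) : PMF Bool :=
  PMF.ofFintype (fun b => cond b (ENNReal.ofReal (p : ℝ)) (ENNReal.ofReal (1 - (p : ℝ)))) (by
    rw [Fintype.sum_bool]
    simp only [cond_true, cond_false]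
    rw [← ENNReal.ofReal_add p.2.1 (sub_nonneg.2 p.2.2), add_sub_cancel, ENNReal.ofReal_one])

/-- The law of the answer `A(i, j) ⊕ X`, with `X` Bernoulli of parameter `p`, to one query. -/
def answerLaw {n m : ℕ} (p : unitInterval) (A : ApprovalProfile n m) (q : ApprovalQuery n m) :
    PMF Bool :=
  (noiseLaw p).map fun x => xor (decide (q.2 ∈ A q.1)) x

/-- A randomized, adaptive algorithm: given all queries and answers so far, it chooses at random
either its next query (`Sum.inl`) or to stop and return a set of candidates (`Sum.inr`).
It need not stop, and no bound on its computing power is imposed. -/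
abbrev QueryAlgorithm (n m : ℕ) : Type :=
  Transcript n m → PMF (ApprovalQuery n m ⊕ Finset (Fin m))

/-- The transcript together with the returned set, if the algorithm has stopped already. -/
abbrev RunState (n m : ℕ) : Type := Transcript n m × Option (Finset (Fin m))

/-- One step of the algorithm on the profile `A`. The noise in an answer is drawn afresh for every
query (also when a query is repeated), independently of everything before. A state in which the
algorithm has stopped does not change any more. -/
def stepLaw {n m : ℕ} (p : unitInterval) (A : ApprovalProfile n m) (alg : QueryAlgorithm n m) :
    RunState n m → PMF (RunState n m)
  | (h, some W) => PMF.pure (h, some W)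
  | (h, none) => (alg h).bind fun a =>
      match a with
      | Sum.inl q => (answerLaw p A q).map fun y => ((q, y) :: h, none)
      | Sum.inr W => PMF.pure (h, some W)

/-- The law of the state after `t` steps, starting from the empty transcript. -/
def runLaw {n m : ℕ} (p : unitInterval) (A : ApprovalProfile n m) (alg : QueryAlgorithm n m) :
    ℕ → PMF (RunState n m)
  | 0 => PMF.pure ([], none)
  | t + 1 => (runLaw p A alg t).bind (stepLaw p A alg)

/-- The probability that the algorithm eventually stops and returns a set with property `P`: the
increasing limit of the probabilities that it has done so within `t` steps. -/
def returnProb {n m : ℕ} (p : unitInterval) (A : ApprovalProfile n m) (alg : QueryAlgorithm n m)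
    (P : Finset (Fin m) → Prop) : ℝ≥0∞ :=
  ⨆ t : ℕ, (runLaw p A alg t).toOuterMeasure {s | ∃ W, s.2 = some W ∧ P W}

/-- The expected number `E[τ]` of queries that the algorithm makes in total (possibly `∞`): the
increasing limit of the expected number `E[min(τ, t)]` of queries made in the first `t` steps. -/
def expectedQueries {n m : ℕ} (p : unitInterval) (A : ApprovalProfile n m)
    (alg : QueryAlgorithm n m) : ℝ≥0∞ :=
  ⨆ t : ℕ, ∑' s : RunState n m, runLaw p A alg t s * (s.1.length : ℝ≥0∞)

end

/-! Compare the empty profile with the `n * m` profiles having a single approval `x = (i, j)`. On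
the latter every approximate committee contains `j`, so "the returned `k`-set contains `j`" has
probability almost `1 - δ` there; on the empty profile its average over `j` is at most `k / m`,
since a `k`-set contains only `k` candidates. Telling the two apart costs queries: the laws of the
answers differ only at `x`, so the divergence of the runs is `flipDivergence p` times the expected
number of queries to `x` on the empty profile. Summed over `x`, this is `flipDivergence p` times the
expected total number of queries.

The divergence is bounded below by `E_A f - E_B exp f + 1` (`expect_sub_expect_exp_le`) with
two-valued `f`. This is linear in the two probabilities, so summing over `x` needs no convexity
argument (`two_valued_le_length`). One choice of values yields the `log (1 / δ)` growth, another a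
positive constant when `δ` is not small; `mul_log_le_length` combines them. -/

/-! ### Expectations of real functions under finitely supported laws -/

namespace PMF

variable {α β : Type*}

/-- The expectation of a real function; meaningful when `μ` has finite support. -/
noncomputable def expect (μ : PMF α) (f : α → ℝ) : ℝ := ∑' a, (μ a).toReal * f a

theorem finite_support_mul {μ : PMF α} (hμ : μ.support.Finite) (f : α → ℝ) :
    (Function.support fun a => (μ a).toReal * f a).Finite := by
  refine hμ.subset fun a ha => ?_
  rw [PMF.mem_support_iff]
  intro h
  simp [h] at ha

theorem summable_expect {μ : PMF α} (hμ : μ.support.Finite) (f : α → ℝ) :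
    Summable fun a => (μ a).toReal * f a :=
  summable_of_hasFiniteSupport (finite_support_mul hμ f)

theorem expect_add {μ : PMF α} (hμ : μ.support.Finite) (f g : α → ℝ) :
    μ.expect (fun a => f a + g a) = μ.expect f + μ.expect g := by
  simp only [expect, mul_add]
  exact (summable_expect hμ f).tsum_add (summable_expect hμ g)

theorem expect_const_mul (μ : PMF α) (c : ℝ) (f : α → ℝ) :
    μ.expect (fun a => c * f a) = c * μ.expect f := by
  simp only [expect, mul_left_comm _ c]
  exact tsum_mul_left

theorem expect_const (μ : PMF α) (c : ℝ) : μ.expect (fun _ => c) = c := by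
  simp only [expect]
  rw [tsum_mul_right, ← ENNReal.tsum_toReal_eq μ.apply_ne_top, μ.tsum_coe]
  simp

theorem expect_sum {ι : Type*} {μ : PMF α} (hμ : μ.support.Finite) (s : Finset ι)
    (f : ι → α → ℝ) :
    μ.expect (fun a => ∑ i ∈ s, f i a) = ∑ i ∈ s, μ.expect (f i) := by
  simp only [expect, Finset.mul_sum]
  exact Summable.tsum_finsetSum fun i _ => summable_expect hμ (f i)

theorem expect_mono {μ : PMF α} (hμ : μ.support.Finite) {f g : α → ℝ} (h : ∀ a, f a ≤ g a) :
    μ.expect f ≤ μ.expect g :=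
  (summable_expect hμ f).tsum_le_tsum
    (fun a => mul_le_mul_of_nonneg_left (h a) ENNReal.toReal_nonneg) (summable_expect hμ g)

theorem expect_pure (a : α) (f : α → ℝ) : (PMF.pure a).expect f = f a := by
  rw [expect, tsum_eq_single a]
  · simp
  · intro b hb
    simp [PMF.pure_apply, hb]

theorem finite_support_bind {μ : PMF α} (hμ : μ.support.Finite) {κ : α → PMF β}
    (hκ : ∀ a, (κ a).support.Finite) : (μ.bind κ).support.Finite := by
  rw [PMF.support_bind]
  exact hμ.biUnion fun a _ => hκ a

theorem finite_support_pure (a : α) : (PMF.pure a).support.Finite := by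
  rw [PMF.support_pure]
  exact Set.finite_singleton a

theorem expect_bind {μ : PMF α} (hμ : μ.support.Finite) {κ : α → PMF β}
    (hκ : ∀ a, (κ a).support.Finite) (f : β → ℝ) :
    (μ.bind κ).expect f = μ.expect fun a => (κ a).expect f := by
  have hz : ∀ a ∉ hμ.toFinset, μ a = 0 := fun a ha => by
    simpa [PMF.mem_support_iff] using ha
  have hb : ∀ b, ((μ.bind κ) b).toReal * f b =
      ∑ a ∈ hμ.toFinset, (μ a).toReal * ((κ a b).toReal * f b) := by
    intro b
    rw [PMF.bind_apply, tsum_eq_sum (s := hμ.toFinset) (fun a ha => by simp [hz a ha]),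
      ENNReal.toReal_sum (fun a _ => ENNReal.mul_ne_top (μ.apply_ne_top a) ((κ a).apply_ne_top b)),
      Finset.sum_mul]
    simp only [ENNReal.toReal_mul, mul_assoc]
  simp only [expect, hb]
  rw [Summable.tsum_finsetSum fun a _ => (summable_expect (hκ a) f).mul_left _,
    tsum_eq_sum (s := hμ.toFinset) (fun a ha => by simp [hz a ha])]
  simp only [tsum_mul_left]

theorem expect_map {μ : PMF α} (hμ : μ.support.Finite) (g : α → β) (f : β → ℝ) :
    (μ.map g).expect f = μ.expect (f ∘ g) := by
  rw [PMF.map, expect_bind hμ (κ := PMF.pure ∘ g) fun a => finite_support_pure (g a)]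
  simp only [Function.comp_apply, expect_pure]
  rfl

theorem toOuterMeasure_toReal (μ : PMF α) (s : Set α) :
    (μ.toOuterMeasure s).toReal = μ.expect (s.indicator 1) := by
  rw [PMF.toOuterMeasure_apply, ENNReal.tsum_toReal_eq, expect]
  · refine tsum_congr fun a => ?_
    by_cases h : a ∈ s <;> simp [h]
  · intro a
    by_cases h : a ∈ s <;> simp [h, μ.apply_ne_top]

end PMF

/-! ### Change of measure along a run -/

section Run

variable {n m : ℕ}

theorem finite_support_stepLaw (p : unitInterval) (A : ApprovalProfile n m)
    (alg : QueryAlgorithm n m) (s : RunState n m) : (stepLaw p A alg s).support.Finite := by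
  obtain ⟨h, _ | W⟩ := s
  · refine PMF.finite_support_bind (Set.toFinite _) ?_
    rintro (q | W)
    · exact PMF.finite_support_bind (Set.toFinite _) fun _ => PMF.finite_support_pure _
    · exact PMF.finite_support_pure _
  · exact PMF.finite_support_pure _

/-- Each step has finitely many outcomes, so no integrability questions arise at a finite time. -/
theorem finite_support_runLaw (p : unitInterval) (A : ApprovalProfile n m)
    (alg : QueryAlgorithm n m) (t : ℕ) : (runLaw p A alg t).support.Finite := by
  induction t with
  | zero => exact PMF.finite_support_pure _
  | succ t ih => exact PMF.finite_support_bind ih (finite_support_stepLaw p A alg)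

theorem expect_runLaw_succ (p : unitInterval) (A : ApprovalProfile n m)
    (alg : QueryAlgorithm n m) (t : ℕ) (f : RunState n m → ℝ) :
    (runLaw p A alg (t + 1)).expect f =
      (runLaw p A alg t).expect fun s => (stepLaw p A alg s).expect f :=
  PMF.expect_bind (finite_support_runLaw p A alg t) (finite_support_stepLaw p A alg) f

/-- The probability of the answer `y` to the query `q` on the profile `A`. -/
noncomputable def answerProb (p : unitInterval) (A : ApprovalProfile n m) (q : ApprovalQuery n m)
    (y : Bool) : ℝ :=
  if y = decide (q.2 ∈ A q.1) then 1 - (p : ℝ) else p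

theorem answerProb_pos {p : unitInterval} (hp0 : 0 < (p : ℝ)) (hp1 : (p : ℝ) < 1)
    (A : ApprovalProfile n m) (q : ApprovalQuery n m) (y : Bool) : 0 < answerProb p A q y := by
  unfold answerProb
  split_ifs <;> linarith

theorem sum_answerProb (p : unitInterval) (A : ApprovalProfile n m) (q : ApprovalQuery n m) :
    answerProb p A q true + answerProb p A q false = 1 := by
  unfold answerProb
  by_cases h : q.2 ∈ A q.1 <;> simp [h]

theorem expect_answerLaw (p : unitInterval) (A : ApprovalProfile n m) (q : ApprovalQuery n m)
    (f : Bool → ℝ) :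
    (answerLaw p A q).expect f = answerProb p A q true * f true +
      answerProb p A q false * f false := by
  have h0 : (0 : ℝ) ≤ p := p.2.1
  have h1 : (0 : ℝ) ≤ 1 - p := sub_nonneg.2 p.2.2
  rw [answerLaw, PMF.expect_map (Set.toFinite _), PMF.expect, tsum_fintype, Fintype.sum_bool]
  by_cases h : q.2 ∈ A q.1 <;>
    simp [noiseLaw, answerProb, h, ENNReal.toReal_ofReal h0, ENNReal.toReal_ofReal h1, add_comm]

theorem expect_stepLaw_none (p : unitInterval) (A : ApprovalProfile n m)
    (alg : QueryAlgorithm n m) (h : Transcript n m) (f : RunState n m → ℝ) :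
    (stepLaw p A alg (h, none)).expect f = (alg h).expect fun a =>
      Sum.elim (fun q => answerProb p A q true * f ((q, true) :: h, none) +
        answerProb p A q false * f ((q, false) :: h, none)) (fun W => f (h, some W)) a := by
  rw [stepLaw, PMF.expect_bind (Set.toFinite _)]
  · congr 1
    funext a
    rcases a with q | W
    · exact (PMF.expect_map (Set.toFinite _) _ _).trans (expect_answerLaw p A q _)
    · exact PMF.expect_pure _ _
  · rintro (q | W)
    · exact PMF.finite_support_bind (Set.toFinite _) fun _ => PMF.finite_support_pure _
    · exact PMF.finite_support_pure _

theorem expect_stepLaw_some (p : unitInterval) (A : ApprovalProfile n m)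
    (alg : QueryAlgorithm n m) (h : Transcript n m) (W : Finset (Fin m)) (f : RunState n m → ℝ) :
    (stepLaw p A alg (h, some W)).expect f = f (h, some W) :=
  PMF.expect_pure _ _

/-- The likelihood ratio of a transcript under the profiles `B` and `A`. -/
noncomputable def likelihoodRatio (p : unitInterval) (A B : ApprovalProfile n m)
    (h : Transcript n m) : ℝ :=
  (h.map fun x => answerProb p B x.1 x.2 / answerProb p A x.1 x.2).prod

/-- The Kullback-Leibler divergence between the answers to `q` under `A` and under `B`. -/
noncomputable def queryDivergence (p : unitInterval) (A B : ApprovalProfile n m)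
    (q : ApprovalQuery n m) : ℝ :=
  answerProb p A q true * -Real.log (answerProb p B q true / answerProb p A q true) +
    answerProb p A q false * -Real.log (answerProb p B q false / answerProb p A q false)

/-- The sum of the divergences of the queries in a transcript. -/
noncomputable def transcriptDivergence (p : unitInterval) (A B : ApprovalProfile n m)
    (h : Transcript n m) : ℝ :=
  (h.map fun x => queryDivergence p A B x.1).sum

variable {p : unitInterval}

theorem likelihoodRatio_pos (hp0 : 0 < (p : ℝ)) (hp1 : (p : ℝ) < 1) (A B : ApprovalProfile n m)
    (h : Transcript n m) : 0 < likelihoodRatio p A B h := by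
  refine List.prod_pos fun x hx => ?_
  obtain ⟨y, -, rfl⟩ := List.mem_map.1 hx
  exact div_pos (answerProb_pos hp0 hp1 B _ _) (answerProb_pos hp0 hp1 A _ _)

theorem likelihoodRatio_cons (A B : ApprovalProfile n m) (x : ApprovalQuery n m × Bool)
    (h : Transcript n m) :
    likelihoodRatio p A B (x :: h) =
      answerProb p B x.1 x.2 / answerProb p A x.1 x.2 * likelihoodRatio p A B h := by
  simp [likelihoodRatio]

/-- Change of measure: expectations under `B` are likelihood-weighted expectations under `A`. -/
theorem expect_runLaw_change (hp0 : 0 < (p : ℝ)) (hp1 : (p : ℝ) < 1) (A B : ApprovalProfile n m)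
    (alg : QueryAlgorithm n m) (t : ℕ) (f : RunState n m → ℝ) :
    (runLaw p B alg t).expect f =
      (runLaw p A alg t).expect fun s => likelihoodRatio p A B s.1 * f s := by
  induction t generalizing f with
  | zero => simp [runLaw, PMF.expect_pure, likelihoodRatio]
  | succ t ih =>
    rw [expect_runLaw_succ, expect_runLaw_succ, ih]
    congr 1
    funext s
    obtain ⟨h, _ | W⟩ := s
    -- The internal randomness `alg h` is the same under both profiles, so only the answer
    -- probabilities enter the ratio.
    · rw [expect_stepLaw_none, expect_stepLaw_none, ← PMF.expect_const_mul]
      congr 1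
      funext a
      rcases a with q | W
      · have h1 := (answerProb_pos hp0 hp1 A q true).ne'
        have h2 := (answerProb_pos hp0 hp1 A q false).ne'
        simp only [Sum.elim_inl, likelihoodRatio_cons]
        field_simp
      · rfl
    · rw [expect_stepLaw_some, expect_stepLaw_some]

/-- The log-likelihood ratio, compensated by the divergences of the queries, is a martingale. -/
theorem expect_log_likelihoodRatio (hp0 : 0 < (p : ℝ)) (hp1 : (p : ℝ) < 1)
    (A B : ApprovalProfile n m) (alg : QueryAlgorithm n m) (t : ℕ) :
    ((runLaw p A alg t).expect fun s =>
      Real.log (likelihoodRatio p A B s.1) + transcriptDivergence p A B s.1) = 0 := by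
  induction t with
  | zero => simp [runLaw, PMF.expect_pure, likelihoodRatio, transcriptDivergence]
  | succ t ih =>
    rw [expect_runLaw_succ, ← ih]
    congr 1
    funext s
    obtain ⟨h, _ | W⟩ := s
    · rw [expect_stepLaw_none, ← PMF.expect_const (alg h)
        (Real.log (likelihoodRatio p A B h) + transcriptDivergence p A B h)]
      congr 1
      funext a
      rcases a with q | W
      · have hl := (likelihoodRatio_pos hp0 hp1 A B h).ne'
        have hr : ∀ y, answerProb p B q y / answerProb p A q y ≠ 0 := fun y =>
          (div_pos (answerProb_pos hp0 hp1 B q y) (answerProb_pos hp0 hp1 A q y)).ne'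
        have hs := sum_answerProb p A q
        simp only [Sum.elim_inl, likelihoodRatio_cons, Real.log_mul (hr _) hl,
          transcriptDivergence, List.map_cons, List.sum_cons]
        have hd := queryDivergence.eq_1 p A B q
        linear_combination (Real.log (likelihoodRatio p A B h) +
          (List.map (fun x => queryDivergence p A B x.1) h).sum +
          queryDivergence p A B q) * hs + hd
      · rfl
    · rw [expect_stepLaw_some]

/-- A linearized form of the Donsker-Varadhan inequality for the run of an algorithm. -/
theorem expect_sub_expect_exp_le (hp0 : 0 < (p : ℝ)) (hp1 : (p : ℝ) < 1)
    (A B : ApprovalProfile n m) (alg : QueryAlgorithm n m) (t : ℕ) (f : RunState n m → ℝ) :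
    (runLaw p A alg t).expect f - (runLaw p B alg t).expect (fun s => Real.exp (f s)) + 1 ≤
      (runLaw p A alg t).expect fun s => transcriptDivergence p A B s.1 := by
  have hf := finite_support_runLaw p A alg t
  have h0 := expect_log_likelihoodRatio hp0 hp1 A B alg t
  rw [PMF.expect_add hf] at h0
  rw [expect_runLaw_change hp0 hp1 A B]
  -- This is `y + 1 ≤ exp y` at `y = f + log L`, where `L` is the likelihood ratio.
  have key : (runLaw p A alg t).expect (fun s => (f s + Real.log (likelihoodRatio p A B s.1)) + 1)
      ≤ (runLaw p A alg t).expect fun s => likelihoodRatio p A B s.1 * Real.exp (f s) := by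
    refine PMF.expect_mono hf fun s => ?_
    have := Real.add_one_le_exp (f s + Real.log (likelihoodRatio p A B s.1))
    rwa [Real.exp_add, Real.exp_log (likelihoodRatio_pos hp0 hp1 A B s.1), mul_comm] at this
  rw [PMF.expect_add hf, PMF.expect_add hf, PMF.expect_const] at key
  linarith

/-- The inequality for a test function taking the value `a` on `E` and `b` off `E`. -/
theorem two_valued_le_divergence (hp0 : 0 < (p : ℝ)) (hp1 : (p : ℝ) < 1)
    (A B : ApprovalProfile n m) (alg : QueryAlgorithm n m) (t : ℕ) (E : Set (RunState n m))
    (a b : ℝ) :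
    b + (a - b) * (runLaw p A alg t).expect (E.indicator 1) -
        (Real.exp b + (Real.exp a - Real.exp b) * (runLaw p B alg t).expect (E.indicator 1)) + 1 ≤
      (runLaw p A alg t).expect fun s => transcriptDivergence p A B s.1 := by
  have hexp := expect_sub_expect_exp_le hp0 hp1 A B alg t
    (fun s => b + (a - b) * E.indicator 1 s)
  have he : (fun s => Real.exp (b + (a - b) * E.indicator (1 : RunState n m → ℝ) s)) =
      fun s => Real.exp b + (Real.exp a - Real.exp b) * E.indicator 1 s := by
    funext s
    by_cases hs : s ∈ E <;> simp [hs]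
  rwa [he, PMF.expect_add (finite_support_runLaw p A alg t),
    PMF.expect_add (finite_support_runLaw p B alg t), PMF.expect_const, PMF.expect_const,
    PMF.expect_const_mul, PMF.expect_const_mul] at hexp

/-- The probability that the algorithm has returned a set satisfying `P` grows with time. -/
theorem monotone_returned (p : unitInterval) (A : ApprovalProfile n m) (alg : QueryAlgorithm n m)
    (P : Finset (Fin m) → Prop) :
    Monotone fun t =>
      (runLaw p A alg t).expect ({s | ∃ W, s.2 = some W ∧ P W}.indicator 1) := by
  refine monotone_nat_of_le_succ fun t => ?_
  rw [expect_runLaw_succ]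
  refine PMF.expect_mono (finite_support_runLaw p A alg t) fun s => ?_
  obtain ⟨h, _ | W⟩ := s
  · rw [Set.indicator_of_notMem (by simp)]
    rw [← PMF.expect_const (stepLaw p A alg (h, none)) 0]
    exact PMF.expect_mono (finite_support_stepLaw p A alg _) fun s =>
      Set.indicator_nonneg (fun _ _ => zero_le_one) s
  · rw [expect_stepLaw_some]

/-- The supremum over times need not be attained, hence the loss from `y` to `x`. -/
theorem exists_time_lt_returned (p : unitInterval) (A : ApprovalProfile n m)
    (alg : QueryAlgorithm n m) (P : Finset (Fin m) → Prop) {x y : ℝ} (hxy : x < y) (hy : 0 < y)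
    (h : ENNReal.ofReal y ≤ returnProb p A alg P) :
    ∃ t, ∀ u, t ≤ u →
      x < (runLaw p A alg u).expect ({s | ∃ W, s.2 = some W ∧ P W}.indicator 1) := by
  have hlt : ENNReal.ofReal x < returnProb p A alg P :=
    ((ENNReal.ofReal_lt_ofReal_iff hy).2 hxy).trans_le h
  obtain ⟨t, ht⟩ := lt_iSup_iff.1 hlt
  refine ⟨t, fun u hu => lt_of_lt_of_le ?_ (monotone_returned p A alg P hu)⟩
  have hfin : (runLaw p A alg t).toOuterMeasure {s | ∃ W, s.2 = some W ∧ P W} ≠ ∞ := by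
    refine ne_top_of_le_ne_top ENNReal.one_ne_top ?_
    rw [PMF.toOuterMeasure_apply, ← (runLaw p A alg t).tsum_coe]
    exact ENNReal.tsum_le_tsum fun s => Set.indicator_le_self _ _ s
  beta_reduce
  rw [← PMF.toOuterMeasure_toReal]
  by_contra! hle
  exact absurd ((ENNReal.ofReal_toReal hfin).symm.trans_le (ENNReal.ofReal_le_ofReal hle))
    (not_le.2 ht)

theorem ofReal_expect_length_le (p : unitInterval) (A : ApprovalProfile n m)
    (alg : QueryAlgorithm n m) (t : ℕ) :
    ENNReal.ofReal ((runLaw p A alg t).expect fun s => (s.1.length : ℝ)) ≤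
      expectedQueries p A alg := by
  refine le_trans (le_of_eq ?_) (le_iSup _ t)
  rw [PMF.expect, ENNReal.ofReal_tsum_of_nonneg (fun s => by positivity)
    (PMF.summable_expect (finite_support_runLaw p A alg t) _)]
  refine tsum_congr fun s => ?_
  rw [ENNReal.ofReal_mul ENNReal.toReal_nonneg, ENNReal.ofReal_toReal (PMF.apply_ne_top _ _),
    ENNReal.ofReal_natCast]

end Run

/-! ### The hard instances -/

section Instances

variable {n m : ℕ}

/-- The profile in which nobody approves anybody. -/
def emptyProfile (n m : ℕ) : ApprovalProfile n m := fun _ => ∅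

/-- The profile in which the only approval is that of candidate `x.2` by voter `x.1`. -/
def singleProfile (x : ApprovalQuery n m) : ApprovalProfile n m :=
  fun i => if i = x.1 then {x.2} else ∅

theorem mem_singleProfile {x q : ApprovalQuery n m} : q.2 ∈ singleProfile x q.1 ↔ q = x := by
  unfold singleProfile
  split_ifs with h <;> simp [Prod.ext_iff, h]

/-- A set missing `x.2` scores zero, while some `k`-set scores positively; any positive
approximation factor would do. -/
theorem mem_of_isApproxCommittee_singleProfile {x : ApprovalQuery n m} {k : ℕ}
    {W : Finset (Fin m)} (hk : 1 ≤ k) (hkm : k ≤ m)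
    (h : IsApproxCommittee (singleProfile x) k W) : x.2 ∈ W := by
  obtain ⟨-, h⟩ := h
  by_contra hx
  have hn : 0 < n := x.1.pos
  obtain ⟨W', hW', -, hcard⟩ := Finset.exists_subsuperset_card_eq
    (Finset.subset_univ {x.2}) (by simpa using hk) (by simpa using hkm)
  have hpos : 0 < ccScore (singleProfile x) W' := by
    refine mul_pos (by positivity) (Finset.sum_pos' (fun i _ => by positivity)
      ⟨x.1, Finset.mem_univ _, ?_⟩)
    rw [if_pos]
    · exact one_pos
    · exact ⟨x.2, Finset.mem_inter.2 ⟨by simp [singleProfile], hW' (by simp)⟩⟩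
  have hzero : ccScore (singleProfile x) W = 0 := by
    refine mul_eq_zero_of_right _ (Finset.sum_eq_zero fun i _ => if_neg ?_)
    rintro ⟨j, hj⟩
    rw [Finset.mem_inter] at hj
    have := (mem_singleProfile (x := x) (q := (i, j))).1 hj.1
    exact hx (this ▸ hj.2)
  have he : 0 < 1 - 1 / Real.exp 1 := by
    rw [sub_pos, div_lt_one (Real.exp_pos 1)]
    exact Real.one_lt_exp_iff.2 one_pos
  have := h W' hcard
  rw [hzero] at this
  exact absurd this (not_le.2 (mul_pos he hpos))

/-- The divergence between the Bernoulli laws of parameters `p` and `1 - p`. -/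
noncomputable def flipDivergence (p : unitInterval) : ℝ :=
  (1 - 2 * (p : ℝ)) * Real.log ((1 - p) / p)

theorem flipDivergence_pos {p : unitInterval} (hp0 : 0 < (p : ℝ)) (hp : (p : ℝ) < 1 / 2) :
    0 < flipDivergence p :=
  mul_pos (by linarith) (Real.log_pos ((one_lt_div hp0).2 (by linarith)))

theorem queryDivergence_single {p : unitInterval} (hp0 : 0 < (p : ℝ)) (hp1 : (p : ℝ) < 1)
    (x q : ApprovalQuery n m) :
    queryDivergence p (emptyProfile n m) (singleProfile x) q =
      if q = x then flipDivergence p else 0 := by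
  have h1 : (1 - (p : ℝ)) ≠ 0 := by linarith
  unfold queryDivergence answerProb
  simp only [mem_singleProfile, emptyProfile, Finset.notMem_empty]
  by_cases h : q = x
  · simp only [h, decide_true, decide_false, if_true, Bool.true_eq_false, Bool.false_eq_true,
      if_false, flipDivergence]
    rw [← inv_div (1 - (p : ℝ)) (p : ℝ), Real.log_inv]
    ring
  · simp [h, h1, hp0.ne']

/-- Each query is informative for exactly one of the profiles, namely the one whose approval it
probes. -/
theorem sum_transcriptDivergence_single {p : unitInterval} (hp0 : 0 < (p : ℝ))
    (hp1 : (p : ℝ) < 1) (h : Transcript n m) :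
    ∑ x, transcriptDivergence p (emptyProfile n m) (singleProfile x) h =
      flipDivergence p * h.length := by
  induction h with
  | nil => simp [transcriptDivergence]
  | cons y h ih =>
    simp only [transcriptDivergence, List.map_cons, List.sum_cons, List.length_cons,
      Finset.sum_add_distrib] at ih ⊢
    rw [ih]
    simp only [queryDivergence_single hp0 hp1, Finset.sum_ite_eq, Finset.mem_univ, if_true]
    push_cast
    ring

/-- The states in which a committee of size `k` containing `j` has been returned. -/
def returnedWith (k : ℕ) (j : Fin m) : Set (RunState n m) :=
  {s | ∃ W, s.2 = some W ∧ W.card = k ∧ j ∈ W}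

theorem sum_expect_returnedWith_le (μ : PMF (RunState n m)) (hμ : μ.support.Finite) (k : ℕ) :
    ∑ j, μ.expect ((returnedWith k j).indicator 1) ≤ k := by
  rw [← PMF.expect_sum hμ, ← PMF.expect_const μ (k : ℝ)]
  refine PMF.expect_mono hμ fun s => ?_
  obtain ⟨h, _ | W⟩ := s
  · rw [Finset.sum_eq_zero]
    · positivity
    · intro j _
      simp [returnedWith]
  · by_cases hW : W.card = k
    · have : ∀ j, (returnedWith k j).indicator (1 : RunState n m → ℝ) (h, some W) =
          if j ∈ W then 1 else 0 := fun j => by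
        simp [returnedWith, Set.indicator_apply, hW]
      simp [this, hW]
    · rw [Finset.sum_eq_zero]
      · positivity
      · intro j _
        simp [returnedWith, hW]

/-- Summing the inequality for a two-valued test function with `a ≤ b` over all single-approval
profiles. -/
theorem two_valued_le_length {p : unitInterval} (hp0 : 0 < (p : ℝ)) (hp1 : (p : ℝ) < 1)
    (alg : QueryAlgorithm n m) (t k : ℕ) {r a b : ℝ} (hab : a ≤ b)
    (hr : ∀ x : ApprovalQuery n m,
      r ≤ (runLaw p (singleProfile x) alg t).expect ((returnedWith k x.2).indicator 1)) :
    (n : ℝ) * (m * (b - (Real.exp b + (Real.exp a - Real.exp b) * r) + 1) + (a - b) * k) ≤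
      flipDivergence p *
        (runLaw p (emptyProfile n m) alg t).expect fun s => (s.1.length : ℝ) := by
  have hf := finite_support_runLaw p (emptyProfile n m) alg t
  rw [← PMF.expect_const_mul]
  simp only [← sum_transcriptDivergence_single hp0 hp1]
  rw [PMF.expect_sum hf]
  have hle : ∀ x : ApprovalQuery n m,
      (b - (Real.exp b + (Real.exp a - Real.exp b) * r) + 1) + (a - b) *
        (runLaw p (emptyProfile n m) alg t).expect ((returnedWith k x.2).indicator 1) ≤
      (runLaw p (emptyProfile n m) alg t).expect fun s =>
        transcriptDivergence p (emptyProfile n m) (singleProfile x) s.1 := fun x => by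
    refine le_trans ?_ (two_valued_le_divergence hp0 hp1 _ _ alg t (returnedWith k x.2) a b)
    -- Since `a ≤ b`, a larger probability under `singleProfile x` only lowers `E_B exp f`, so `r`
    -- may replace it.
    nlinarith [mul_nonneg (sub_nonneg.2 (Real.exp_le_exp.2 hab)) (sub_nonneg.2 (hr x))]
  refine le_trans ?_ (Finset.sum_le_sum fun x _ => hle x)
  generalize b - (Real.exp b + (Real.exp a - Real.exp b) * r) + 1 = c
  rw [Fintype.sum_prod_type]
  simp only [Finset.sum_add_distrib, Finset.sum_const, Finset.card_univ, Fintype.card_fin,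
    nsmul_eq_mul, ← Finset.mul_sum]
  rw [← mul_add]
  refine mul_le_mul_of_nonneg_left ?_ (Nat.cast_nonneg n)
  have := sum_expect_returnedWith_le (runLaw p (emptyProfile n m) alg t) hf k
  nlinarith [mul_nonneg (sub_nonneg.2 hab) (sub_nonneg.2 this)]

/-- The lower bound on the expected length of the transcript up to time `t`. -/
theorem mul_log_le_length {p : unitInterval} (hp0 : 0 < (p : ℝ)) (hp1 : (p : ℝ) < 1)
    (alg : QueryAlgorithm n m) (t k : ℕ) {δ η : ℝ} (hδ : 0 < δ) (hη : 0 < η) (hη1 : η ≤ 1)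
    (hδ1 : δ ≤ 1) (hk : δ * m + k ≤ (1 - η) * m)
    (hr : ∀ x : ApprovalQuery n m, 1 - δ ≤
      (runLaw p (singleProfile x) alg t).expect ((returnedWith k x.2).indicator 1)) :
    η ^ 3 / (1 + η ^ 2) * (n * m * Real.log (1 / δ)) ≤ flipDivergence p *
      (runLaw p (emptyProfile n m) alg t).expect fun s => (s.1.length : ℝ) := by
  set X := flipDivergence p *
    (runLaw p (emptyProfile n m) alg t).expect fun s => (s.1.length : ℝ)
  have hℓ : 0 ≤ Real.log (1 / δ) := Real.log_nonneg ((one_le_div hδ).2 hδ1)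
  have hm : (0 : ℝ) ≤ m := Nat.cast_nonneg m
  have hn : (0 : ℝ) ≤ n := Nat.cast_nonneg n
  have hlog : n * m * (η * Real.log (1 / δ) - 1) ≤ X := by
    -- `exp f` is `1 / 2` on the event and `1 / (2 * δ)` off it, so at probability `1 - δ` its mean
    -- is `1 - δ / 2`, below `1`.
    have h := two_valued_le_length hp0 hp1 alg t k (a := -Real.log 2)
      (b := Real.log (1 / δ) - Real.log 2) (by linarith) hr
    rw [Real.exp_sub, Real.exp_neg, Real.exp_log two_pos, Real.exp_log (by positivity)] at h
    have hexp : 1 / δ / 2 + (2⁻¹ - 1 / δ / 2) * (1 - δ) = 1 - δ / 2 := by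
      field_simp
      ring
    rw [hexp] at h
    refine le_trans ?_ h
    rw [mul_assoc]
    refine mul_le_mul_of_nonneg_left ?_ hn
    have h2 : Real.log 2 ≤ 1 := by linarith [Real.log_two_lt_d9]
    have h3 : (k : ℝ) ≤ (1 - η) * m := by nlinarith
    nlinarith [mul_le_mul_of_nonneg_left h3 hℓ, mul_le_mul_of_nonneg_left h2 hm,
      mul_nonneg hm hδ.le]
  have hsq : n * m * η ^ 2 ≤ X := by
    -- To first order the gain is `2 * η * (1 - δ - k / m) ≥ 2 * η ^ 2`; the quadratic error of
    -- `exp` costs at most `η ^ 2`.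
    have h := two_valued_le_length hp0 hp1 alg t k (a := -η) (b := η) (by linarith) hr
    refine le_trans ?_ h
    rw [mul_assoc]
    refine mul_le_mul_of_nonneg_left ?_ hn
    have e1 : Real.exp η ≤ 1 + η + η ^ 2 := by
      have := (abs_le.1 (Real.abs_exp_sub_one_sub_id_le (x := η) (abs_le.2 ⟨by linarith, hη1⟩))).2
      linarith
    have e2 : Real.exp (-η) ≤ 1 - η + η ^ 2 := by
      have := (abs_le.1 (Real.abs_exp_sub_one_sub_id_le (x := -η)
        (abs_le.2 ⟨by linarith, by linarith⟩))).2
      linarith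
    have e3 : Real.exp η + (Real.exp (-η) - Real.exp η) * (1 - δ) ≤
        1 + η ^ 2 + η * (2 * δ - 1) := by
      nlinarith [mul_le_mul_of_nonneg_left e1 hδ.le,
        mul_le_mul_of_nonneg_left e2 (sub_nonneg.2 hδ1)]
    nlinarith [mul_le_mul_of_nonneg_left e3 hm, mul_le_mul_of_nonneg_left hk hη.le]
  rw [div_mul_eq_mul_div, div_le_iff₀ (by positivity)]
  -- Adding `η ^ 2` times `hlog` to `hsq` cancels the `-1`.
  nlinarith [mul_le_mul_of_nonneg_left hlog (sq_nonneg η)]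

end Instances

theorem theorem4 (p : unitInterval) (hp0 : 0 < (p : ℝ)) (hp : (p : ℝ) < 1 / 2)
    (η : ℝ) (hη : 0 < η) :
    ∃ c : ℝ, 0 < c ∧
      ∀ (n m k : ℕ) (δ : ℝ), 1 ≤ n → 1 ≤ k → k ≤ m → 0 < δ → δ + (k : ℝ) / (m : ℝ) ≤ 1 - η →
        ∀ alg : QueryAlgorithm n m,
          (∀ A : ApprovalProfile n m,
            ENNReal.ofReal (1 - δ) ≤ returnProb p A alg (IsApproxCommittee A k)) →
          ∃ A : ApprovalProfile n m,
            ENNReal.ofReal (c * ((n : ℝ) * (m : ℝ) * Real.log (1 / δ))) ≤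
              expectedQueries p A alg := by
  have hp1 : (p : ℝ) < 1 := by linarith
  have hD := flipDivergence_pos hp0 hp
  refine ⟨(η / 2) ^ 3 / (1 + (η / 2) ^ 2) / (2 * flipDivergence p), by positivity, ?_⟩
  intro n m k δ hn hk hkm hδ hδk alg halg
  refine ⟨emptyProfile n m, ?_⟩
  have hm : (0 : ℝ) < m := by exact_mod_cast hk.trans hkm
  have hkm0 : (0 : ℝ) ≤ (k : ℝ) / m := by positivity
  have hδ1 : δ < 1 := by linarith
  -- Success by a finite time holds only with a larger error. The bound `√δ` costs a factor 2 in the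
  -- logarithm, and `δ + η / 2` keeps half of the gap `η`.
  set δ' := min (√δ) (δ + η / 2)
  have hδδ' : δ < δ' :=
    lt_min ((Real.lt_sqrt hδ.le).2 (by nlinarith)) (by linarith)
  have hδ'2 : δ' ≤ δ + η / 2 := min_le_right _ _
  have hlog : Real.log (1 / δ) / 2 ≤ Real.log (1 / δ') := by
    have h := Real.log_le_log (hδ.trans hδδ') (min_le_left (√δ) (δ + η / 2))
    rw [Real.log_sqrt hδ.le] at h
    rw [one_div, one_div, Real.log_inv, Real.log_inv]
    linarith
  have hex : ∀ x : ApprovalQuery n m, ∃ t, ∀ u, t ≤ u → 1 - δ' <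
      (runLaw p (singleProfile x) alg u).expect ((returnedWith k x.2).indicator 1) := by
    intro x
    obtain ⟨t, ht⟩ := exists_time_lt_returned p (singleProfile x) alg _
      (by linarith : 1 - δ' < 1 - δ) (by linarith) (halg (singleProfile x))
    refine ⟨t, fun u hu => (ht u hu).trans_le
      (PMF.expect_mono (finite_support_runLaw p _ alg u) fun s => ?_)⟩
    refine Set.indicator_le_indicator_of_subset ?_ (fun _ => zero_le_one) s
    rintro s ⟨W, hW, hP⟩
    exact ⟨W, hW, hP.1, mem_of_isApproxCommittee_singleProfile hk hkm hP⟩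
  choose T hT using hex
  -- There are finitely many single-approval profiles, so one time serves them all.
  set t := Finset.univ.sup T
  refine le_trans (ENNReal.ofReal_le_ofReal ?_) (ofReal_expect_length_le p _ alg t)
  have hmain := mul_log_le_length hp0 hp1 alg t k (hδ.trans hδδ') (η := η / 2) (by positivity)
    (by linarith) (by linarith)
    (by
      have : (δ' + (k : ℝ) / m) * m ≤ (1 - η / 2) * m :=
        mul_le_mul_of_nonneg_right (by linarith) hm.le
      rwa [add_mul, div_mul_cancel₀ _ hm.ne'] at this)
    (fun x => (hT x t (Finset.le_sup (Finset.mem_univ x))).le)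
  have hc : (0 : ℝ) ≤ (η / 2) ^ 3 / (1 + (η / 2) ^ 2) * (n * m) := by positivity
  rw [div_mul_eq_mul_div, div_le_iff₀ (by positivity)]
  nlinarith [mul_le_mul_of_nonneg_left hlog hc]
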